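/- Words are over the alphabet $\{1,2\}$ and letters of an infinite word are numbered $n=1,2,3,\dots$. Let $\sigma_1\colon 1\mapsto 1,\ 2\mapsto 12$ and $\sigma_2\colon 1\mapsto 21,\ 2\mapsto 2$, extended to finite words by concatenation. A \emph{standard Sturmian word} is an infinite word $w$ for which there is a sequence $(s_n)_{n\ge1}$ in $\{\sigma_1,\sigma_2\}$, containing each of $\sigma_1$ and $\sigma_2$ infinitely often, such that the finite words $s_1\circ\cdots\circ s_n(1)$ and $s_1\circ\cdots\circ s_n(2)$ both converge to $w$ as $n\to\infty$ (i.e. every prefix of $w$ is a prefix of these words for all large $n$). The \emph{frequency} of the letter $a$ in $w$ is the limit, if it exists, of the proportion of letters $a$ among the first $n$ letters of $w$. For $\theta=(\theta_1,\theta_2)\in(\mathbb R_{>0})^2$ and $x\in[0,1)^2$ define the following infinite words, only positive times being considered. - $w_{\mathrm{billiard}}(x,\theta)$: a ball starts at $x$ with momentum $\theta$ on the table $[0,1]^2$, moves in straight lines and is reflected at the edges; the $n$-th letter is $1$ if the $n$-th edge hit is vertical and $2$ if it is horizontal (defined if no corner is hit at a positive time). - $w_{\mathrm{line}}(x,\theta)$: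 the $n$-th letter is $1$ if the $n$-th intersection of the half-line $\{x+t\theta : t>0\}$ with the grid $(\mathbb Z\times\mathbb R)\cup(\mathbb R\times\mathbb Z)$ is on a vertical branch $\mathbb Z\times\mathbb R$, and $2$ otherwise (defined if the half-line avoids $\mathbb Z^2$). - $w_{\mathrm{flow}}(x,\theta)$: the $n$-th letter is $1$ if the $n$-th time $t>0$ at which $x+t\theta$ in the torus $\mathbb R^2/\mathbb Z^2$ belongs to $P=\{0\}\times[0,1)\,\cup\,[0,1)\times\{0\}$, it belongs to the vertical branch $\{0\}\times[0,1)$, and $2$ otherwise (defined if the orbit avoids the point $(0,0)$ at positive times). For $y\in[0,1)$ and $\alpha\in(0,1)$, the $n$-th letter of $w_{\mathrm{rotation}}(y,\alpha)$ is $1$ if $R_\alpha^{n-1}(y)\in[0,1-\alpha)$ and $2$ otherwise, where $R_\alpha(y)=y+\alpha \bmod 1$ on $[0,1)$. \textbf{Theorem.} Let $w$ be a standard Sturmian word. Then $w$ admits letter frequencies $(f_1,f_2)$, with $f_1>0$ and $0<f_2<1$; the billiard, line and flow trajectories from the origin in direction $(f_1,f_2)$ hit no corner at a positive time; and $$w =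 w_{\mathrm{billiard}}(0,(f_1,f_2)) = w_{\mathrm{line}}(0,(f_1,f_2)) = w_{\mathrm{flow}}(0,(f_1,f_2)) = w_{\mathrm{rotation}}(f_2,f_2).$$ -/

import Mathlib

open Filter Topology

namespace Sturmian

/-- The binary alphabet `{1, 2}`. -/
inductive Letter where
  | one : Letter
  | two : Letter
  deriving DecidableEq

/-- Infinite binary words. Indices start at `0`: the value `w n` is the `(n+1)`-th letter. -/
abbrev InfWord := ℕ → Letter

/-- The prefix of length `n` of an infinite word. -/
def pref (w : InfWord) (n : ℕ) : List Letter := (List.range n).map w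

/-- The letter `a` has frequency `f` in `w`: the proportion of `a` in the prefix of length `n`
tends to `f`. -/
def HasLetterFreq (w : InfWord) (a : Letter) (f : ℝ) : Prop :=
  Tendsto (fun n : ℕ => ((pref w n).count a : ℝ) / (n : ℝ)) atTop (𝓝 f)

/-! ### Standard Sturmian words -/

/-- The substitutions `σ₁ : 1 ↦ 1, 2 ↦ 12` and `σ₂ : 1 ↦ 21, 2 ↦ 2`. -/
def sigma : Letter → Letter → List Letter
  | .one, .one => [.one]
  | .one, .two => [.one, .two]
  | .two, .one => [.two, .one]
  | .two, .two => [.two]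

/-- The morphism of finite words induced by a substitution. -/
def applySubst (σ : Letter → List Letter) (u : List Letter) : List Letter := u.flatMap σ

/-- `iterSubst s n u` is `s₁ ∘ s₂ ∘ ⋯ ∘ sₙ (u)`, where the `k`-th substitution `sₖ` is
`sigma (s (k - 1))`. -/
def iterSubst (s : ℕ → Letter) : ℕ → List Letter → List Letter
  | 0, u => u
  | n + 1, u => iterSubst s n (applySubst (sigma (s n)) u)

/-- The finite words `u n` converge to the infinite word `w`: they share larger and larger
prefixes with `w`. -/
def WordsTendsto (u : ℕ → List Letter) (w : InfWord) : Prop :=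
  ∀ N : ℕ, ∀ᶠ n in atTop, pref w N <+: u n

/-- `w` is a standard Sturmian word: for some sequence `(sₙ)` in `{σ₁, σ₂}` that contains both
substitutions infinitely often, `s₁ ∘ ⋯ ∘ sₙ (1)` and `s₁ ∘ ⋯ ∘ sₙ (2)` both converge to `w`. -/
def IsStandardSturmian (w : InfWord) : Prop :=
  ∃ s : ℕ → Letter, (∀ i : Letter, ∃ᶠ n in atTop, s n = i) ∧
    ∀ a : Letter, WordsTendsto (fun n => iterSubst s n [a]) w

/-! ### Billiard words -/

/-- The two vertical edges of the table `[0,1]²`. -/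
def verticalEdges : Set (ℝ × ℝ) := {p | (p.1 = 0 ∨ p.1 = 1) ∧ p.2 ∈ Set.Icc (0 : ℝ) 1}

/-- The two horizontal edges of the table `[0,1]²`. -/
def horizontalEdges : Set (ℝ × ℝ) := {p | p.1 ∈ Set.Icc (0 : ℝ) 1 ∧ (p.2 = 0 ∨ p.2 = 1)}

/-- The first positive time at which a ball at position `p` with momentum `v` hits an edge. -/
noncomputable def hitTime (p v : ℝ × ℝ) : ℝ :=
  sInf {t : ℝ | 0 < t ∧ p + t • v ∈ verticalEdges ∪ horizontalEdges}

open Classical in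
/-- The momentum after a bounce at the point `q` of the boundary: a vertical edge reverses the
horizontal component, a horizontal edge reverses the vertical component. -/
noncomputable def reflect (q v : ℝ × ℝ) : ℝ × ℝ :=
  (if q ∈ verticalEdges then -v.1 else v.1, if q ∈ horizontalEdges then -v.2 else v.2)

/-- From a state (position, momentum), the ball moves in a straight line until it hits an edge and
bounces there. The result is the state just after the bounce. -/
noncomputable def billiardStep (s : (ℝ × ℝ) × (ℝ × ℝ)) : (ℝ × ℝ) × (ℝ × ℝ) :=
  (s.1 + hitTime s.1 s.2 • s.2, reflect (s.1 + hitTime s.1 s.2 • s.2) s.2)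

/-- The point of the boundary at which the `(n+1)`-th hit takes place. -/
noncomputable def hitPoint (x θ : ℝ × ℝ) (n : ℕ) : ℝ × ℝ := (billiardStep^[n + 1] (x, θ)).1

/-- The billiard trajectory hits no corner of the table (at positive times). -/
def BilliardAvoidsCorners (x θ : ℝ × ℝ) : Prop :=
  ∀ n : ℕ, ¬ (hitPoint x θ n ∈ verticalEdges ∧ hitPoint x θ n ∈ horizontalEdges)

open Classical in
/-- The billiard word: the letter is `1` if the hit edge is vertical, and `2` if it is
horizontal. -/
noncomputable def billiardWord (x θ : ℝ × ℝ) : InfWord := fun n =>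
  if hitPoint x θ n ∈ verticalEdges then .one else .two

/-! ### Cutting sequences -/

/-- `t` is the `(n+1)`-th element of `T`, in increasing order. -/
def IsNth (T : Set ℝ) (n : ℕ) (t : ℝ) : Prop := t ∈ T ∧ (T ∩ Set.Iio t).encard = n

/-- The vertical branches `ℤ × ℝ` of the integer grid. -/
def gridVertical : Set (ℝ × ℝ) := {p | ∃ k : ℤ, p.1 = k}

/-- The horizontal branches `ℝ × ℤ` of the integer grid. -/
def gridHorizontal : Set (ℝ × ℝ) := {p | ∃ k : ℤ, p.2 = k}

/-- The parameters `t > 0` at which the half-line `x + tθ` meets the grid. -/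
def lineTimes (x θ : ℝ × ℝ) : Set ℝ := {t | 0 < t ∧ x + t • θ ∈ gridVertical ∪ gridHorizontal}

/-- The half-line `x + tθ`, `t > 0`, passes through no grid intersection. -/
def LineAvoidsCorners (x θ : ℝ × ℝ) : Prop :=
  ∀ t : ℝ, 0 < t → ¬ (x + t • θ ∈ gridVertical ∧ x + t • θ ∈ gridHorizontal)

open Classical in
/-- The cutting sequence of the half-line `x + tθ`, `t > 0`: the letter is `1` if the corresponding
intersection with the grid is on a vertical branch, and `2` otherwise. -/
noncomputable def lineWord (x θ : ℝ × ℝ) : InfWord := fun n =>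
  if ∃ t : ℝ, IsNth (lineTimes x θ) n t ∧ x + t • θ ∈ gridVertical then .one else .two

/-! ### Linear flow on the torus -/

/-- The torus `ℝ²/ℤ²`. -/
abbrev Torus := UnitAddCircle × UnitAddCircle

/-- The linear flow with direction `θ` on the torus. -/
noncomputable def torusFlow (θ : ℝ × ℝ) (t : ℝ) (p : Torus) : Torus :=
  (p.1 + ((t * θ.1 : ℝ) : UnitAddCircle), p.2 + ((t * θ.2 : ℝ) : UnitAddCircle))

/-- The vertical branch `{0} × [0,1)` of the Poincaré section. -/
def sectionVertical : Set Torus := {p | p.1 = 0}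

/-- The horizontal branch `[0,1) × {0}` of the Poincaré section. -/
def sectionHorizontal : Set Torus := {p | p.2 = 0}

/-- The positive times at which the orbit of `x` crosses the Poincaré section. -/
def flowTimes (x : Torus) (θ : ℝ × ℝ) : Set ℝ :=
  {t | 0 < t ∧ torusFlow θ t x ∈ sectionVertical ∪ sectionHorizontal}

/-- The orbit of `x` does not pass through the corner point `(0,0)` at positive times. -/
def FlowAvoidsCorner (x : Torus) (θ : ℝ × ℝ) : Prop :=
  ∀ t : ℝ, 0 < t → torusFlow θ t x ≠ (0, 0)

open Classical in
/-- The flow word: the letter is `1` if the corresponding crossing of the Poincaré section is via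
its vertical branch, and `2` otherwise. -/
noncomputable def flowWord (x : Torus) (θ : ℝ × ℝ) : InfWord := fun n =>
  if ∃ t : ℝ, IsNth (flowTimes x θ) n t ∧ torusFlow θ t x ∈ sectionVertical then .one else .two

/-! ### Rotations -/

/-- The rotation `y ↦ y + α mod 1` of the circle `ℝ/ℤ = [0,1)`. -/
noncomputable def rotation (α y : ℝ) : ℝ := Int.fract (y + α)

open Classical in
/-- The coding of the orbit of `y ∈ [0,1)` under the rotation by `α`: the letter is `1` if the
current point lies in `[0, 1 - α)`, and `2` otherwise. -/
noncomputable def rotationWord (y α : ℝ) : InfWord := fun n =>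
  if (rotation α)^[n] y ∈ Set.Ico 0 (1 - α) then .one else .two

end Sturmian

/-!
The substitutions `σ₁` and `σ₂` reverse the passage from a rotation to a first return map: they
send the coding of the rotation by `α` started at `α` to the coding of the rotation by
`α / (1 + α)`, respectively `1 / (2 - α)`, again started at the angle. By compactness there is a
sequence of angles compatible with a given directive sequence, so a standard Sturmian word is
`rotationWord α α`, and `α` is the frequency of the letter `2`. If one angle of the sequence were
rational, then all later ones would be, with strictly decreasing denominators; hence `α` is
irrational and the half-line from the origin in direction `(1 - α, α)` meets no other lattice point.

At integer times this half-line is on an antidiagonal, at a point congruent to `(1 - y, y)` modulo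
`ℤ²`, and `y` moves under the rotation by `α`. Between consecutive positive integer times it meets
the grid exactly once, on a vertical branch if `y < 1 - α` and on a horizontal one if `y > 1 - α`.
The flow is the image of the line in the torus, and the billiard trajectory is the image of the line
under the folding of the plane onto the table `[0, 1]²`.
-/

namespace Sturmian

/-! ### Coding of rotations -/

theorem pref_succ (w : InfWord) (n : ℕ) : pref w (n + 1) = w 0 :: pref (fun k => w (k + 1)) n := by
  simp [pref, List.range_succ_eq_map, Function.comp_def]

theorem length_pref (w : InfWord) (n : ℕ) : (pref w n).length = n := by
  simp [pref]

section Rotation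

variable {α y : ℝ}

theorem rotation_of_lt (hα : 0 ≤ α) (hy : 0 ≤ y) (h : y < 1 - α) : rotation α y = y + α :=
  Int.fract_eq_self.2 ⟨by linarith, by linarith⟩

theorem rotation_of_le (hα : α ≤ 1) (hy : y < 1) (h : 1 - α ≤ y) : rotation α y = y + α - 1 :=
  Int.fract_eq_iff.2 ⟨by linarith, by linarith, 1, by push_cast; ring⟩

theorem rotationWord_succ (y α : ℝ) (n : ℕ) :
    rotationWord y α (n + 1) = rotationWord (rotation α y) α n :=
  rfl

theorem rotationWord_zero_of_lt (hy : 0 ≤ y) (h : y < 1 - α) : rotationWord y α 0 = .one :=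
  if_pos ⟨hy, h⟩

theorem rotationWord_zero_of_le (h : 1 - α ≤ y) : rotationWord y α 0 = .two :=
  if_neg fun hy => h.not_gt hy.2

theorem pref_rotationWord_of_lt (hα : 0 ≤ α) (hy : 0 ≤ y) (h : y < 1 - α) (n : ℕ) :
    pref (rotationWord y α) (n + 1) = .one :: pref (rotationWord (y + α) α) n := by
  simp only [pref_succ, rotationWord_succ, rotationWord_zero_of_lt hy h, rotation_of_lt hα hy h]

theorem pref_rotationWord_of_le (hα : α ≤ 1) (hy : y < 1) (h : 1 - α ≤ y) (n : ℕ) :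
    pref (rotationWord y α) (n + 1) = .two :: pref (rotationWord (y + α - 1) α) n := by
  simp only [pref_succ, rotationWord_succ, rotationWord_zero_of_le h, rotation_of_le hα hy h]

theorem count_two_pref_rotationWord (hα : α ∈ Set.Icc 0 1) (hy : y ∈ Set.Ico 0 1) (n : ℕ) :
    ((pref (rotationWord y α) n).count .two : ℤ) = ⌊y + n * α⌋ := by
  induction n generalizing y with
  | zero => simpa [pref, eq_comm, Int.floor_eq_zero_iff] using hy
  | succ n ih =>
    rcases lt_or_ge y (1 - α) with h | h
    · rw [pref_rotationWord_of_lt hα.1 hy.1 h, List.count_cons_of_ne (by decide),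
        ih ⟨add_nonneg hy.1 hα.1, by linarith⟩]
      congr 1
      push_cast
      ring
    · have hshift : y + (n + 1 : ℕ) * α = y + α - 1 + n * α + 1 := by push_cast; ring
      rw [pref_rotationWord_of_le hα.2 hy.2 h, List.count_cons_self, hshift, Int.floor_add_one,
        Nat.cast_succ, ih ⟨by linarith, by linarith [hy.2, hα.2]⟩]

theorem tendsto_floor_add_mul_div (y α : ℝ) :
    Tendsto (fun n : ℕ => (⌊y + n * α⌋ : ℝ) / n) atTop (𝓝 α) := by
  have hlim (c : ℝ) : Tendsto (fun n : ℕ => α + c / n) atTop (𝓝 α) := by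
    simpa using tendsto_const_nhds.add (tendsto_const_div_atTop_nhds_zero_nat c)
  refine tendsto_of_tendsto_of_tendsto_of_le_of_le' (hlim (y - 1)) (hlim y) ?_ ?_
  · filter_upwards [eventually_gt_atTop 0] with n hn
    have hn' : (0 : ℝ) < n := Nat.cast_pos.2 hn
    rw [le_div_iff₀ hn', add_mul, div_mul_cancel₀ _ hn'.ne']
    linarith [Int.lt_floor_add_one (y + n * α)]
  · filter_upwards [eventually_gt_atTop 0] with n hn
    have hn' : (0 : ℝ) < n := Nat.cast_pos.2 hn
    rw [div_le_iff₀ hn', add_mul, div_mul_cancel₀ _ hn'.ne']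
    linarith [Int.floor_le (y + n * α)]

theorem hasLetterFreq_two_rotationWord (hα : α ∈ Set.Icc 0 1) (hy : y ∈ Set.Ico 0 1) :
    HasLetterFreq (rotationWord y α) .two α := by
  refine (tendsto_floor_add_mul_div y α).congr fun n => ?_
  rw [← count_two_pref_rotationWord hα hy n, Int.cast_natCast]

end Rotation

theorem count_one_add_count_two (u : List Letter) : u.count .one + u.count .two = u.length := by
  induction u with
  | nil => rfl
  | cons a u ih => cases a <;> simp <;> omega

theorem HasLetterFreq.one_of_two {w : InfWord} {f : ℝ} (h : HasLetterFreq w .two f) :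
    HasLetterFreq w .one (1 - f) := by
  refine (tendsto_const_nhds.sub h).congr' ?_
  filter_upwards [eventually_gt_atTop 0] with n hn
  have hcount : ((pref w n).count .one + (pref w n).count .two : ℝ) = n := by
    exact_mod_cast (count_one_add_count_two _).trans (length_pref w n)
  have hn' : (n : ℝ) ≠ 0 := Nat.cast_ne_zero.2 hn.ne'
  field_simp
  linarith

/-! ### Renormalization of rotations -/

theorem applySubst_cons (σ : Letter → List Letter) (a : Letter) (u : List Letter) :
    applySubst σ (a :: u) = σ a ++ applySubst σ u :=
  List.flatMap_cons

section Renormalization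

variable {α y : ℝ}

-- The rotation by `α` is, up to rescaling, the first return map of the rotation by `α / (1 + α)`
-- to `[0, 1 / (1 + α))`, and the orbit segments between returns read `1` and `12`.
theorem exists_applySubst_sigma_one_eq_pref (hα : α ∈ Set.Icc 0 1) (hy : y ∈ Set.Ico 0 1)
    (N : ℕ) : ∃ L, applySubst (sigma .one) (pref (rotationWord y α) N) =
      pref (rotationWord (y / (1 + α)) (α / (1 + α))) L := by
  have hpos : 0 < 1 + α := by linarith [hα.1]
  have hslope : α / (1 + α) ∈ Set.Icc 0 1 :=
    ⟨div_nonneg hα.1 hpos.le, (div_le_one hpos).2 (by linarith)⟩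
  have hcompl : 1 - α / (1 + α) = 1 / (1 + α) := by field_simp; ring
  induction N generalizing y with
  | zero => exact ⟨0, rfl⟩
  | succ N ih =>
    have hnonneg : 0 ≤ y / (1 + α) := div_nonneg hy.1 hpos.le
    have hfirst : y / (1 + α) < 1 - α / (1 + α) := by
      rw [hcompl]
      exact div_lt_div_of_pos_right hy.2 hpos
    rcases lt_or_ge y (1 - α) with h | h
    · obtain ⟨L, hL⟩ := ih (y := y + α) ⟨add_nonneg hy.1 hα.1, by linarith⟩
      refine ⟨L + 1, ?_⟩
      rw [pref_rotationWord_of_lt hα.1 hy.1 h, applySubst_cons, hL,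
        pref_rotationWord_of_lt hslope.1 hnonneg hfirst, ← add_div]
      rfl
    · obtain ⟨L, hL⟩ := ih (y := y + α - 1) ⟨by linarith, by linarith [hy.2, hα.2]⟩
      have hreturn : (y + α) / (1 + α) + α / (1 + α) - 1 = (y + α - 1) / (1 + α) := by
        field_simp
        ring
      refine ⟨L + 2, ?_⟩
      rw [pref_rotationWord_of_le hα.2 hy.2 h, applySubst_cons, hL,
        pref_rotationWord_of_lt hslope.1 hnonneg hfirst, ← add_div,
        pref_rotationWord_of_le hslope.2 ((div_lt_one hpos).2 (by linarith [hy.2])) ?_, hreturn]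
      · rfl
      · rw [hcompl]
        exact div_le_div_of_nonneg_right (by linarith) hpos.le

-- The rotation by `α` is, up to an affine change of coordinate, the first return map of the
-- rotation by `1 / (2 - α)` to `[(1 - α) / (2 - α), 1)`.
theorem exists_applySubst_sigma_two_eq_pref (hα : α ∈ Set.Icc 0 1) (hy : y ∈ Set.Ico 0 1)
    (N : ℕ) : ∃ L, applySubst (sigma .two) (pref (rotationWord y α) N) =
      pref (rotationWord ((y + 1 - α) / (2 - α)) (1 / (2 - α))) L := by
  have hpos : 0 < 2 - α := by linarith [hα.2]
  have hslope : 1 / (2 - α) ∈ Set.Icc 0 1 :=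
    ⟨by positivity, (div_le_one hpos).2 (by linarith [hα.2])⟩
  have hcompl : 1 - 1 / (2 - α) = (1 - α) / (2 - α) := by field_simp; ring
  induction N generalizing y with
  | zero => exact ⟨0, rfl⟩
  | succ N ih =>
    have hlt : (y + 1 - α) / (2 - α) < 1 := (div_lt_one hpos).2 (by linarith [hy.2])
    have hfirst : 1 - 1 / (2 - α) ≤ (y + 1 - α) / (2 - α) := by
      rw [hcompl]
      exact div_le_div_of_nonneg_right (by linarith [hy.1]) hpos.le
    have hmove : (y + 1 - α) / (2 - α) + 1 / (2 - α) - 1 = y / (2 - α) := by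
      field_simp
      ring
    rcases lt_or_ge y (1 - α) with h | h
    · obtain ⟨L, hL⟩ := ih (y := y + α) ⟨add_nonneg hy.1 hα.1, by linarith⟩
      have hreturn : y / (2 - α) + 1 / (2 - α) = (y + α + 1 - α) / (2 - α) := by
        rw [← add_div]
        ring
      refine ⟨L + 2, ?_⟩
      rw [pref_rotationWord_of_lt hα.1 hy.1 h, applySubst_cons, hL,
        pref_rotationWord_of_le hslope.2 hlt hfirst, hmove,
        pref_rotationWord_of_lt hslope.1 (div_nonneg hy.1 hpos.le) ?_, hreturn]
      · rfl
      · rw [hcompl]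
        exact div_lt_div_of_pos_right h hpos
    · obtain ⟨L, hL⟩ := ih (y := y + α - 1) ⟨by linarith, by linarith [hy.2, hα.2]⟩
      have hreturn : y + α - 1 + 1 - α = y := by ring
      refine ⟨L + 1, ?_⟩
      rw [pref_rotationWord_of_le hα.2 hy.2 h, applySubst_cons, hL, hreturn,
        pref_rotationWord_of_le hslope.2 hlt hfirst, hmove]
      rfl

end Renormalization

/-- The slope of the image of `rotationWord α α` under the morphism `sigma a`: the action of the
two substitutions on the frequency `α` of the letter `2`. -/
noncomputable def substSlope : Letter → ℝ → ℝ
  | .one, α => α / (1 + α)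
  | .two, α => 1 / (2 - α)

theorem exists_applySubst_sigma_eq_pref (a : Letter) {α : ℝ} (hα : α ∈ Set.Ico 0 1) (N : ℕ) :
    ∃ L, applySubst (sigma a) (pref (rotationWord α α) N) =
      pref (rotationWord (substSlope a α) (substSlope a α)) L := by
  cases a with
  | one => exact exists_applySubst_sigma_one_eq_pref (Set.Ico_subset_Icc_self hα) hα N
  | two =>
    simpa only [substSlope, add_sub_cancel_left] using
      exists_applySubst_sigma_two_eq_pref (Set.Ico_subset_Icc_self hα) hα N

theorem exists_iterSubst_eq_pref {s : ℕ → Letter} {x : ℕ → ℝ} (hx : ∀ n, x n ∈ Set.Ico 0 1)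
    (hrec : ∀ n, x n = substSlope (s n) (x (n + 1))) (n N : ℕ) :
    ∃ L, iterSubst s n (pref (rotationWord (x n) (x n)) N) =
      pref (rotationWord (x 0) (x 0)) L := by
  induction n generalizing N with
  | zero => exact ⟨N, rfl⟩
  | succ n ih =>
    obtain ⟨M, hM⟩ := exists_applySubst_sigma_eq_pref (s n) (hx (n + 1)) N
    rw [iterSubst, hM, ← hrec]
    exact ih M

/-! ### The slope of a directive sequence -/

theorem mapsTo_substSlope (a : Letter) :
    Set.MapsTo (substSlope a) (Set.Icc 0 1) (Set.Icc 0 1) := by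
  rintro α ⟨h0, h1⟩
  cases a with
  | one => exact ⟨by rw [substSlope]; positivity, (div_le_one (by linarith)).2 (by linarith)⟩
  | two => exact ⟨div_nonneg zero_le_one (by linarith), (div_le_one (by linarith)).2 (by linarith)⟩

theorem continuousOn_substSlope (a : Letter) : ContinuousOn (substSlope a) (Set.Icc 0 1) := by
  cases a with
  | one => exact continuousOn_id.div (by fun_prop) fun α hα => by linarith [hα.1]
  | two => exact continuousOn_const.div (by fun_prop) fun α hα => by linarith [hα.2]

theorem exists_forall_lt_eq_apply_succ {X : Type*} [Nonempty X] (g : ℕ → X → X) (N : ℕ) :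
    ∃ x : ℕ → X, ∀ n < N, x n = g n (x (n + 1)) := by
  induction N generalizing g with
  | zero => exact ⟨fun _ => Classical.arbitrary X, by simp⟩
  | succ N ih =>
    obtain ⟨x, hx⟩ := ih fun n => g (n + 1)
    refine ⟨fun n => n.casesOn (g 0 (x 0)) x, fun n hn => ?_⟩
    cases n with
    | zero => rfl
    | succ n => exact hx n (by omega)

theorem exists_forall_eq_apply_succ {X : Type*} [TopologicalSpace X] [CompactSpace X] [T2Space X]
    [Nonempty X] {g : ℕ → X → X} (hg : ∀ n, Continuous (g n)) :
    ∃ x : ℕ → X, ∀ n, x n = g n (x (n + 1)) := by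
  let A (N : ℕ) : Set (ℕ → X) := ⋂ n, ⋂ _ : n < N, {x | x n = g n (x (n + 1))}
  have hmem {N : ℕ} {x : ℕ → X} : x ∈ A N ↔ ∀ n < N, x n = g n (x (n + 1)) := Set.mem_iInter₂
  have hclosed (N : ℕ) : IsClosed (A N) := isClosed_iInter fun n => isClosed_iInter fun _ =>
    isClosed_eq (continuous_apply n) ((hg n).comp (continuous_apply (n + 1)))
  obtain ⟨x, hx⟩ := IsCompact.nonempty_iInter_of_sequence_nonempty_isCompact_isClosed A
    (fun N x hx => hmem.2 fun n hn => hmem.1 hx n (by omega))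
    (fun N => (exists_forall_lt_eq_apply_succ g N).imp fun _ => hmem.2)
    (hclosed 0).isCompact hclosed
  exact ⟨x, fun n => hmem.1 (Set.mem_iInter.1 hx (n + 1)) n n.lt_succ_self⟩

theorem exists_forall_eq_substSlope (s : ℕ → Letter) : ∃ x : ℕ → ℝ,
    (∀ n, x n ∈ Set.Icc 0 1) ∧ ∀ n, x n = substSlope (s n) (x (n + 1)) := by
  obtain ⟨x, hx⟩ := exists_forall_eq_apply_succ fun n =>
    (continuousOn_substSlope (s n)).mapsToRestrict (mapsTo_substSlope (s n))
  exact ⟨fun n => x n, fun n => (x n).2, fun n => congrArg Subtype.val (hx n)⟩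

theorem forall_of_frequently_of_succ {P : ℕ → Prop} (hfreq : ∃ᶠ n in atTop, P n)
    (hstep : ∀ n, P (n + 1) → P n) (n : ℕ) : P n := by
  obtain ⟨m, hnm, hm⟩ := frequently_atTop.1 hfreq n
  exact Nat.decreasingInduction (motive := fun k _ => P k) (fun k _ => hstep k) hm hnm

section Slopes

variable {s : ℕ → Letter} {x : ℕ → ℝ}

theorem slope_mem_Ioo (hs : ∀ a : Letter, ∃ᶠ n in atTop, s n = a) (hx : ∀ n, x n ∈ Set.Icc 0 1)
    (hrec : ∀ n, x n = substSlope (s n) (x (n + 1))) (n : ℕ) : x n ∈ Set.Ioo 0 1 := by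
  have hden_one (m : ℕ) : 0 < 1 + x m := by linarith [(hx m).1]
  have hden_two (m : ℕ) : 0 < 2 - x m := by linarith [(hx m).2]
  constructor
  · have hpos_of_two (m : ℕ) (hm : s m = .two) : 0 < x m := by
      rw [hrec m, hm]
      exact one_div_pos.2 (hden_two _)
    refine forall_of_frequently_of_succ ((hs .two).mono hpos_of_two) (fun m hm => ?_) n
    cases hsm : s m with
    | one => rw [hrec m, hsm]; exact div_pos hm (hden_one _)
    | two => exact hpos_of_two m hsm
  · have hlt_of_one (m : ℕ) (hm : s m = .one) : x m < 1 := by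
      rw [hrec m, hm]
      exact (div_lt_one (hden_one _)).2 (by linarith)
    refine forall_of_frequently_of_succ ((hs .one).mono hlt_of_one) (fun m hm => ?_) n
    cases hsm : s m with
    | one => exact hlt_of_one m hsm
    | two => rw [hrec m, hsm]; exact (div_lt_one (hden_two _)).2 (by linarith)

-- If `substSlope a α = p / q`, then `α` is `p / (q - p)` or `(2 * p - q) / p`.
theorem exists_lt_mul_eq_intCast {a : Letter} {α : ℝ} (hα : α ∈ Set.Ioo 0 1) {p q : ℤ}
    (hq : 0 < q) (h : substSlope a α * q = p) :
    ∃ p' q' : ℤ, 0 < q' ∧ q' < q ∧ α * q' = p' := by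
  have hqR : (0 : ℝ) < q := Int.cast_pos.2 hq
  obtain ⟨h0, h1⟩ := hα
  cases a with
  | one =>
    have hpos : 0 < 1 + α := by linarith
    have hp : α * q = p * (1 + α) := by rw [← h, substSlope]; field_simp
    have hp0 : (0 : ℝ) < p := by rw [← h]; exact mul_pos (div_pos h0 hpos) hqR
    have hpq : (p : ℝ) < q := by nlinarith
    refine ⟨p, q - p, sub_pos.2 (Int.cast_lt.1 hpq), sub_lt_self q (Int.cast_pos.1 hp0), ?_⟩
    push_cast
    linarith
  | two =>
    have hpos : 0 < 2 - α := by linarith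
    have hp : (q : ℝ) = p * (2 - α) := by rw [← h, substSlope]; field_simp
    have hp0 : (0 : ℝ) < p := by rw [← h]; exact mul_pos (one_div_pos.2 hpos) hqR
    have hpq : (p : ℝ) < q := by nlinarith
    refine ⟨2 * p - q, p, Int.cast_pos.1 hp0, Int.cast_lt.1 hpq, ?_⟩
    push_cast
    linarith

theorem irrational_slope (hx : ∀ n, x n ∈ Set.Ioo 0 1)
    (hrec : ∀ n, x n = substSlope (s n) (x (n + 1))) (n : ℕ) : Irrational (x n) := by
  have hdescent (q : ℕ) : ∀ (n : ℕ) (p : ℤ), 0 < q → x n * q ≠ p := by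
    induction q using Nat.strong_induction_on with
    | _ q ih =>
      intro n p hq h
      obtain ⟨p', q', hq', hlt, h'⟩ :=
        exists_lt_mul_eq_intCast (hx (n + 1)) (Int.natCast_pos.2 hq) (by rwa [← hrec n])
      lift q' to ℕ using hq'.le
      exact ih q' (Int.ofNat_lt.1 hlt) (n + 1) p' (Int.natCast_pos.1 hq') (by simpa using h')
  rintro ⟨r, hr⟩
  refine hdescent r.den n r.num r.den_pos ?_
  rw [← hr]
  exact_mod_cast r.mul_den_eq_num

end Slopes

theorem apply_eq_of_pref_prefix {v w : InfWord} {m L : ℕ} (h : pref w (m + 1) <+: pref v L) :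
    w m = v m := by
  simpa [pref] using h.getElem (i := m) (by simp [length_pref])

theorem IsStandardSturmian.exists_eq_rotationWord {w : InfWord} (hw : IsStandardSturmian w) :
    ∃ α ∈ Set.Ioo (0 : ℝ) 1, Irrational α ∧ w = rotationWord α α := by
  obtain ⟨s, hs, hlim⟩ := hw
  obtain ⟨x, hx, hrec⟩ := exists_forall_eq_substSlope s
  have hx' := slope_mem_Ioo hs hx hrec
  refine ⟨x 0, hx' 0, irrational_slope hx' hrec 0, funext fun m => ?_⟩
  obtain ⟨n, hone, htwo⟩ := ((hlim .one (m + 1)).and (hlim .two (m + 1))).exists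
  have hprefix : pref w (m + 1) <+: iterSubst s n (pref (rotationWord (x n) (x n)) 1) := by
    cases h : rotationWord (x n) (x n) 0 <;> simpa [pref, h]
  obtain ⟨L, hL⟩ := exists_iterSubst_eq_pref (fun n => Set.Ioo_subset_Ico_self (hx' n)) hrec n 1
  exact apply_eq_of_pref_prefix (hL ▸ hprefix)

/-! ### Cutting sequences -/

theorem isNth_zero_iff {T : Set ℝ} {t : ℝ} : IsNth T 0 t ↔ IsLeast T t := by
  simp only [IsNth, Nat.cast_zero, Set.encard_eq_zero, IsLeast, mem_lowerBounds,
    Set.eq_empty_iff_forall_notMem, Set.mem_inter_iff, Set.mem_Iio, not_and, not_lt]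

theorem IsNth.lt_of_encard_inter_Iic {T : Set ℝ} {s t : ℝ} {k n : ℕ} (ht : IsNth T (k + n) t)
    (hk : (T ∩ Set.Iic s).encard = k) : s < t := by
  by_contra! hts
  have hlt : (T ∩ Set.Iio t).encard < (T ∩ Set.Iic s).encard := by
    refine Set.Finite.encard_lt_encard (Set.finite_of_encard_eq_coe ht.2) ?_
    refine ⟨Set.inter_subset_inter_right T fun u hu => (le_of_lt hu).trans hts, fun h => ?_⟩
    exact lt_irrefl t (h ⟨ht.1, hts⟩).2
  rw [ht.2, hk, Nat.cast_lt] at hlt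
  omega

theorem isNth_add_iff {T : Set ℝ} {s t : ℝ} {k : ℕ} (hk : (T ∩ Set.Iic s).encard = k)
    (ht : 0 < t) (n : ℕ) : IsNth T (k + n) (s + t) ↔ IsNth {u | 0 < u ∧ s + u ∈ T} n t := by
  have hunion : T ∩ Set.Iio (s + t) =
      T ∩ Set.Iic s ∪ (s + ·) '' ({u | 0 < u ∧ s + u ∈ T} ∩ Set.Iio t) := by
    ext v
    constructor
    · rintro ⟨hv, hvt : v < s + t⟩
      rcases le_or_gt v s with hvs | hvs
      · exact .inl ⟨hv, hvs⟩
      · exact .inr ⟨v - s, ⟨⟨sub_pos.2 hvs, by rwa [add_sub_cancel]⟩, sub_lt_iff_lt_add'.2 hvt⟩,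
          add_sub_cancel s v⟩
    · rintro (⟨hv, hvs⟩ | ⟨u, ⟨hu, hut⟩, rfl⟩)
      · exact ⟨hv, lt_of_le_of_lt hvs (lt_add_of_pos_right s ht)⟩
      · exact ⟨hu.2, add_lt_add_right hut s⟩
  have hdisj : Disjoint (T ∩ Set.Iic s) ((s + ·) '' ({u | 0 < u ∧ s + u ∈ T} ∩ Set.Iio t)) := by
    rw [Set.disjoint_left]
    rintro _ ⟨-, hs⟩ ⟨u, ⟨hu, -⟩, rfl⟩
    exact (lt_add_of_pos_right s hu.1).not_ge hs
  rw [IsNth, IsNth, hunion, Set.encard_union_eq hdisj, hk, (add_right_injective s).encard_image,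
    Nat.cast_add, (ENat.addLECancellable_of_ne_top (ENat.natCast_ne_top k)).inj]
  simp only [Set.mem_ofPred_eq, ht, true_and]

/-- The times `t > 0` at which a point moving on the real line from `y` with velocity `v` is at an
integer; the grid is met at the crossing times of the two coordinates. -/
def crossingTimes (y v : ℝ) : Set ℝ := {t | 0 < t ∧ ∃ k : ℤ, y + t * v = k}

section Crossing

variable {y v s : ℝ}

theorem isLeast_crossingTimes (y : ℝ) (hv : 0 < v) :
    IsLeast (crossingTimes y v) ((⌊y⌋ + 1 - y) / v) := by
  refine ⟨⟨div_pos (by linarith [Int.lt_floor_add_one y]) hv, ⌊y⌋ + 1, ?_⟩, ?_⟩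
  · rw [div_mul_cancel₀ _ hv.ne']
    push_cast
    ring
  · rintro t ⟨ht, k, hk⟩
    have hlt : ⌊y⌋ < k := Int.floor_lt.2 (by linarith [mul_pos ht hv])
    have hle : (⌊y⌋ : ℝ) + 1 ≤ k := by exact_mod_cast hlt
    rw [div_le_iff₀ hv]
    linarith

theorem crossingTimes_inter_Iic_eq_empty (hv : 0 < v) (h : y + s * v < ⌊y⌋ + 1) :
    crossingTimes y v ∩ Set.Iic s = ∅ := by
  refine Set.eq_empty_of_forall_notMem fun t ⟨ht, hts⟩ => ?_
  have hle := (div_le_iff₀ hv).1 (((isLeast_crossingTimes y hv).2 ht).trans hts)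
  linarith

theorem crossingTimes_inter_Iic_eq_singleton (hv : 0 < v)
    (h : y + s * v ∈ Set.Ico ((⌊y⌋ : ℝ) + 1) (⌊y⌋ + 2)) :
    crossingTimes y v ∩ Set.Iic s = {(⌊y⌋ + 1 - y) / v} := by
  have hleast := isLeast_crossingTimes y hv
  refine Set.eq_singleton_iff_unique_mem.2
    ⟨⟨hleast.1, (div_le_iff₀ hv).2 (by linarith [h.1])⟩, fun t ⟨ht, (hts : t ≤ s)⟩ => ?_⟩
  obtain ⟨k, hk⟩ := ht.2
  have hlb := (div_le_iff₀ hv).1 (hleast.2 ht)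
  have hub := mul_le_mul_of_nonneg_right hts hv.le
  have hk_lb : ⌊y⌋ + 1 ≤ k := by
    exact_mod_cast (by linarith : (⌊y⌋ : ℝ) + 1 ≤ k)
  have hk_ub : k < ⌊y⌋ + 2 := by
    exact_mod_cast (by linarith [h.2] : (k : ℝ) < ⌊y⌋ + 2)
  obtain rfl : k = ⌊y⌋ + 1 := by omega
  rw [eq_div_iff hv.ne']
  push_cast at hk
  linarith

end Crossing

section Line

variable {x θ : ℝ × ℝ}

theorem lineTimes_eq_union (x θ : ℝ × ℝ) :
    lineTimes x θ = crossingTimes x.1 θ.1 ∪ crossingTimes x.2 θ.2 :=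
  Set.ext fun _ => and_or_left

theorem mem_lineTimes_add_smul_iff {s t : ℝ} (hs : 0 ≤ s) :
    t ∈ lineTimes (x + s • θ) θ ↔ 0 < t ∧ s + t ∈ lineTimes x θ := by
  simp only [lineTimes, Set.mem_ofPred_eq, add_smul, add_assoc]
  exact and_congr_right fun ht => by simp [add_pos_of_nonneg_of_pos hs ht]

theorem lineWord_add {s : ℝ} {k : ℕ} (hs : 0 ≤ s)
    (hk : (lineTimes x θ ∩ Set.Iic s).encard = k) (n : ℕ) :
    lineWord x θ (k + n) = lineWord (x + s • θ) θ n := by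
  classical
  have hshift : lineTimes (x + s • θ) θ = {u | 0 < u ∧ s + u ∈ lineTimes x θ} :=
    Set.ext fun _ => mem_lineTimes_add_smul_iff hs
  refine if_congr ⟨?_, ?_⟩ rfl rfl
  · rintro ⟨t, ht, hmem⟩
    have hst : 0 < t - s := sub_pos.2 (ht.lt_of_encard_inter_Iic hk)
    refine ⟨t - s, ?_, ?_⟩
    · rw [hshift, ← isNth_add_iff hk hst, add_sub_cancel]
      exact ht
    · rwa [add_assoc, ← add_smul, add_sub_cancel]
  · rintro ⟨t, ht, hmem⟩
    refine ⟨s + t, (isNth_add_iff hk ht.1.1 n).2 (hshift ▸ ht), ?_⟩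
    rwa [add_smul, ← add_assoc]

theorem lineWord_eq_lineWord_add_smul {s : ℝ} (hs : 0 ≤ s) (h : lineTimes x θ ∩ Set.Iic s = ∅) :
    lineWord x θ = lineWord (x + s • θ) θ := by
  funext n
  rw [← lineWord_add (k := 0) hs (by simp [h]), zero_add]

theorem lineWord_succ {r s : ℝ} (hs : 0 ≤ s) (h : lineTimes x θ ∩ Set.Iic s = {r}) (n : ℕ) :
    lineWord x θ (n + 1) = lineWord (x + s • θ) θ n := by
  rw [← lineWord_add (k := 1) hs (by simp [h]), add_comm]

open Classical in
theorem lineWord_zero {r : ℝ} (hr : IsLeast (lineTimes x θ) r) :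
    lineWord x θ 0 = if x + r • θ ∈ gridVertical then .one else .two := by
  refine if_congr ?_ rfl rfl
  simp only [isNth_zero_iff]
  exact ⟨fun ⟨t, ht, hmem⟩ => ht.unique hr ▸ hmem, fun hmem => ⟨r, hr, hmem⟩⟩

theorem isLeast_of_inter_Iic_eq_singleton {T : Set ℝ} {r s : ℝ} (h : T ∩ Set.Iic s = {r}) :
    IsLeast T r := by
  have hr : r ∈ T ∩ Set.Iic s := h ▸ Set.mem_singleton r
  refine ⟨hr.1, fun t ht => ?_⟩
  rcases le_total t s with hts | hst
  · exact (show t ∈ ({r} : Set ℝ) from h ▸ ⟨ht, hts⟩).ge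
  · exact le_trans hr.2 hst

theorem inter_Iic_eq_singleton_of_isLeast {T : Set ℝ} {r : ℝ} (h : IsLeast T r) :
    T ∩ Set.Iic r = {r} :=
  Set.eq_singleton_iff_unique_mem.2
    ⟨⟨h.1, Set.self_mem_Iic⟩, fun _ ht => le_antisymm ht.2 (h.2 ht.1)⟩

theorem LineAvoidsCorners.translate {s : ℝ} (h : LineAvoidsCorners x θ) (hs : 0 ≤ s) :
    LineAvoidsCorners (x + s • θ) θ := by
  intro t ht
  rw [add_assoc, ← add_smul]
  exact h (s + t) (add_pos_of_nonneg_of_pos hs ht)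

theorem exists_add_intCast_eq_intCast_iff (y : ℝ) (k : ℤ) :
    (∃ m : ℤ, y + k = m) ↔ ∃ m : ℤ, y = m :=
  ⟨fun ⟨m, hm⟩ => ⟨m - k, by push_cast; linarith⟩, fun ⟨m, hm⟩ => ⟨m + k, by push_cast; linarith⟩⟩

theorem add_intCast_add_mem_gridVertical_iff (p q : ℝ × ℝ) (k l : ℤ) :
    p + ((k : ℝ), (l : ℝ)) + q ∈ gridVertical ↔ p + q ∈ gridVertical := by
  rw [add_right_comm]
  exact exists_add_intCast_eq_intCast_iff (p + q).1 k

theorem add_intCast_add_mem_gridHorizontal_iff (p q : ℝ × ℝ) (k l : ℤ) :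
    p + ((k : ℝ), (l : ℝ)) + q ∈ gridHorizontal ↔ p + q ∈ gridHorizontal := by
  rw [add_right_comm]
  exact exists_add_intCast_eq_intCast_iff (p + q).2 l

theorem lineWord_add_intCast (x θ : ℝ × ℝ) (k l : ℤ) :
    lineWord (x + ((k : ℝ), (l : ℝ))) θ = lineWord x θ := by
  classical
  funext n
  refine if_congr ?_ rfl rfl
  simp only [lineTimes, Set.mem_union, add_intCast_add_mem_gridVertical_iff,
    add_intCast_add_mem_gridHorizontal_iff]

theorem lineAvoidsCorners_add_intCast_iff (k l : ℤ) :
    LineAvoidsCorners (x + ((k : ℝ), (l : ℝ))) θ ↔ LineAvoidsCorners x θ := by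
  simp only [LineAvoidsCorners, add_intCast_add_mem_gridVertical_iff,
    add_intCast_add_mem_gridHorizontal_iff]

end Line

/-! ### Unfolding billiards -/

/-- The first positive time at which the half-line from `p` in a positive direction `θ` meets the
integer grid. -/
noncomputable def gridTime (p θ : ℝ × ℝ) : ℝ :=
  min ((⌊p.1⌋ + 1 - p.1) / θ.1) ((⌊p.2⌋ + 1 - p.2) / θ.2)

section GridTime

variable {θ : ℝ × ℝ}

theorem isLeast_gridTime (hθ₁ : 0 < θ.1) (hθ₂ : 0 < θ.2) (p : ℝ × ℝ) :
    IsLeast (lineTimes p θ) (gridTime p θ) := by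
  rw [lineTimes_eq_union]
  exact (isLeast_crossingTimes p.1 hθ₁).union (isLeast_crossingTimes p.2 hθ₂)

theorem fst_add_mul_le_of_le_gridTime (hθ₁ : 0 < θ.1) {p : ℝ × ℝ} {t : ℝ}
    (ht : t ≤ gridTime p θ) : p.1 + t * θ.1 ≤ ⌊p.1⌋ + 1 := by
  linarith [(le_div_iff₀ hθ₁).1 (ht.trans (min_le_left _ _))]

theorem snd_add_mul_le_of_le_gridTime (hθ₂ : 0 < θ.2) {p : ℝ × ℝ} {t : ℝ}
    (ht : t ≤ gridTime p θ) : p.2 + t * θ.2 ≤ ⌊p.2⌋ + 1 := by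
  linarith [(le_div_iff₀ hθ₂).1 (ht.trans (min_le_right _ _))]

end GridTime

/-- The folding of the real line onto `[0, 1]` by the reflections at the integers: the distance to
the even integer nearest to `y`. -/
noncomputable def fold (y : ℝ) : ℝ := if Even ⌊y⌋ then Int.fract y else 1 - Int.fract y

/-- The slope of `fold` to the right of `y`. -/
noncomputable def foldSign (y : ℝ) : ℝ := if Even ⌊y⌋ then 1 else -1

theorem fold_mem_Icc (y : ℝ) : fold y ∈ Set.Icc 0 1 := by
  have h0 := Int.fract_nonneg y
  have h1 := Int.fract_lt_one y
  unfold fold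
  split_ifs <;> constructor <;> linarith

theorem fold_eq_zero_or_one_iff (y : ℝ) : (fold y = 0 ∨ fold y = 1) ↔ ∃ k : ℤ, y = k := by
  have hfract : (∃ k : ℤ, y = k) ↔ Int.fract y = 0 := by
    simp only [Int.fract_eq_zero_iff, Set.mem_range, eq_comm]
  have h1 := Int.fract_lt_one y
  rw [hfract, fold]
  split_ifs
  · exact or_iff_left h1.ne
  · rw [sub_eq_zero, sub_eq_self, or_iff_right h1.ne']

theorem fold_eq_of_mem_Icc {y : ℝ} {k : ℤ} (h : y ∈ Set.Icc (k : ℝ) (k + 1)) :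
    fold y = if Even k then y - k else k + 1 - y := by
  rcases h.2.lt_or_eq with hlt | rfl
  · have hk : ⌊y⌋ = k := Int.floor_eq_iff.2 ⟨h.1, hlt⟩
    rw [fold, Int.fract, hk]
    split_ifs <;> ring
  · by_cases hk : Even k <;> simp [fold, hk]

section Fold

variable {y d : ℝ}

theorem fold_add (hd : 0 ≤ d) (h : y + d ≤ ⌊y⌋ + 1) : fold (y + d) = fold y + d * foldSign y := by
  have hy := Int.floor_le y
  rw [fold_eq_of_mem_Icc ⟨by linarith, h⟩,
    fold_eq_of_mem_Icc (y := y) ⟨hy, (Int.lt_floor_add_one y).le⟩, foldSign]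
  split_ifs <;> ring

open Classical in
theorem foldSign_add (hd : 0 < d) (h : y + d ≤ ⌊y⌋ + 1) :
    foldSign (y + d) = if ∃ k : ℤ, y + d = k then -foldSign y else foldSign y := by
  have hy := Int.floor_le y
  rcases h.lt_or_eq with hlt | heq
  · have hfloor : ⌊y + d⌋ = ⌊y⌋ := Int.floor_eq_iff.2 ⟨by linarith, hlt⟩
    rw [if_neg, foldSign, hfloor, foldSign]
    rintro ⟨k, hk⟩
    have hlt_k : ⌊y⌋ < k := Int.floor_lt.2 (by linarith)
    rw [hk, Int.floor_intCast] at hfloor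
    omega
  · rw [if_pos ⟨⌊y⌋ + 1, by push_cast; exact heq⟩, heq]
    by_cases he : Even ⌊y⌋ <;> simp [foldSign, he]

end Fold

/-- The point of the table `[0, 1]²` onto which `p` is folded. -/
noncomputable def foldPoint (p : ℝ × ℝ) : ℝ × ℝ := (fold p.1, fold p.2)

/-- The billiard state (position and momentum) corresponding to the point `p` of the unfolded
trajectory, which moves with constant momentum `θ`. -/
noncomputable def foldState (p θ : ℝ × ℝ) : (ℝ × ℝ) × (ℝ × ℝ) :=
  (foldPoint p, (foldSign p.1 * θ.1, foldSign p.2 * θ.2))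

theorem foldPoint_mem_verticalEdges_iff (p : ℝ × ℝ) :
    foldPoint p ∈ verticalEdges ↔ p ∈ gridVertical :=
  (and_iff_left (fold_mem_Icc p.2)).trans (fold_eq_zero_or_one_iff p.1)

theorem foldPoint_mem_horizontalEdges_iff (p : ℝ × ℝ) :
    foldPoint p ∈ horizontalEdges ↔ p ∈ gridHorizontal :=
  (and_iff_right (fold_mem_Icc p.1)).trans (fold_eq_zero_or_one_iff p.2)

theorem foldState_eq_self {x : ℝ × ℝ} (hx₁ : x.1 ∈ Set.Ico 0 1) (hx₂ : x.2 ∈ Set.Ico 0 1)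
    (θ : ℝ × ℝ) : foldState x θ = (x, θ) := by
  simp [foldState, foldPoint, fold, foldSign, Int.floor_eq_zero_iff.2 hx₁,
    Int.floor_eq_zero_iff.2 hx₂, Int.fract_eq_self.2 hx₁, Int.fract_eq_self.2 hx₂]

section Billiard

variable {θ : ℝ × ℝ}

theorem foldState_flight (hθ₁ : 0 < θ.1) (hθ₂ : 0 < θ.2) {p : ℝ × ℝ} {t : ℝ} (ht : 0 ≤ t)
    (htp : t ≤ gridTime p θ) :
    (foldState p θ).1 + t • (foldState p θ).2 = foldPoint (p + t • θ) := by
  refine Prod.ext ?_ ?_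
  · refine Eq.trans ?_ (fold_add (mul_nonneg ht hθ₁.le)
      (fst_add_mul_le_of_le_gridTime hθ₁ htp)).symm
    simp only [foldState, foldPoint, Prod.fst_add, Prod.smul_fst, smul_eq_mul]
    ring
  · refine Eq.trans ?_ (fold_add (mul_nonneg ht hθ₂.le)
      (snd_add_mul_le_of_le_gridTime hθ₂ htp)).symm
    simp only [foldState, foldPoint, Prod.snd_add, Prod.smul_snd, smul_eq_mul]
    ring

theorem hitTime_foldState (hθ₁ : 0 < θ.1) (hθ₂ : 0 < θ.2) (p : ℝ × ℝ) :
    hitTime (foldState p θ).1 (foldState p θ).2 = gridTime p θ := by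
  have hleast := isLeast_gridTime hθ₁ hθ₂ p
  have hmem {t : ℝ} (ht : 0 < t) (htp : t ≤ gridTime p θ) :
      (foldState p θ).1 + t • (foldState p θ).2 ∈ verticalEdges ∪ horizontalEdges ↔
        t ∈ lineTimes p θ := by
    rw [foldState_flight hθ₁ hθ₂ ht.le htp, Set.mem_union, foldPoint_mem_verticalEdges_iff,
      foldPoint_mem_horizontalEdges_iff]
    exact (and_iff_right ht).symm
  refine IsLeast.csInf_eq ⟨⟨hleast.1.1, (hmem hleast.1.1 le_rfl).2 hleast.1⟩, ?_⟩
  rintro t ⟨ht, htmem⟩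
  by_contra! hlt
  exact hlt.not_ge (hleast.2 ((hmem ht hlt.le).1 htmem))

theorem billiardStep_foldState (hθ₁ : 0 < θ.1) (hθ₂ : 0 < θ.2) (p : ℝ × ℝ) :
    billiardStep (foldState p θ) = foldState (p + gridTime p θ • θ) θ := by
  classical
  have hpos := (isLeast_gridTime hθ₁ hθ₂ p).1.1
  have hsign₁ := foldSign_add (mul_pos hpos hθ₁) (fst_add_mul_le_of_le_gridTime hθ₁ le_rfl)
  have hsign₂ := foldSign_add (mul_pos hpos hθ₂) (snd_add_mul_le_of_le_gridTime hθ₂ le_rfl)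
  rw [billiardStep, hitTime_foldState hθ₁ hθ₂, foldState_flight hθ₁ hθ₂ hpos.le le_rfl]
  refine Prod.ext rfl (Prod.ext ?_ ?_)
  · simp only [reflect, foldPoint_mem_verticalEdges_iff, foldState]
    rw [Prod.fst_add, Prod.smul_fst, smul_eq_mul, hsign₁, ite_mul, neg_mul]
    rfl
  · simp only [reflect, foldPoint_mem_horizontalEdges_iff, foldState]
    rw [Prod.snd_add, Prod.smul_snd, smul_eq_mul, hsign₂, ite_mul, neg_mul]
    rfl

theorem lineWord_succ_gridTime (hθ₁ : 0 < θ.1) (hθ₂ : 0 < θ.2) (p : ℝ × ℝ) (n : ℕ) :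
    lineWord p θ (n + 1) = lineWord (p + gridTime p θ • θ) θ n :=
  have hleast := isLeast_gridTime hθ₁ hθ₂ p
  lineWord_succ hleast.1.1.le (inter_Iic_eq_singleton_of_isLeast hleast) n

open Classical in
theorem lineWord_eq_ite_iterate_billiardStep (hθ₁ : 0 < θ.1) (hθ₂ : 0 < θ.2) (p : ℝ × ℝ) (n : ℕ) :
    lineWord p θ n =
      if (billiardStep^[n + 1] (foldState p θ)).1 ∈ verticalEdges then .one else .two := by
  induction n generalizing p with
  | zero =>
    rw [lineWord_zero (isLeast_gridTime hθ₁ hθ₂ p), zero_add, Function.iterate_one,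
      billiardStep_foldState hθ₁ hθ₂]
    exact if_congr (foldPoint_mem_verticalEdges_iff _).symm rfl rfl
  | succ n ih =>
    rw [lineWord_succ_gridTime hθ₁ hθ₂, ih, Function.iterate_succ_apply billiardStep (n + 1),
      billiardStep_foldState hθ₁ hθ₂]

theorem exists_iterate_billiardStep_foldState (hθ₁ : 0 < θ.1) (hθ₂ : 0 < θ.2) (p : ℝ × ℝ)
    (n : ℕ) : ∃ t : ℝ, 0 < t ∧ billiardStep^[n + 1] (foldState p θ) = foldState (p + t • θ) θ := by
  induction n with
  | zero =>
    exact ⟨gridTime p θ, (isLeast_gridTime hθ₁ hθ₂ p).1.1, billiardStep_foldState hθ₁ hθ₂ p⟩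
  | succ n ih =>
    obtain ⟨t, ht, hstate⟩ := ih
    refine ⟨t + gridTime (p + t • θ) θ,
      add_pos ht (isLeast_gridTime hθ₁ hθ₂ (p + t • θ)).1.1, ?_⟩
    rw [Function.iterate_succ_apply', hstate, billiardStep_foldState hθ₁ hθ₂, add_smul, add_assoc]

theorem billiardWord_eq_lineWord {x : ℝ × ℝ} (hx₁ : x.1 ∈ Set.Ico 0 1) (hx₂ : x.2 ∈ Set.Ico 0 1)
    (hθ₁ : 0 < θ.1) (hθ₂ : 0 < θ.2) : billiardWord x θ = lineWord x θ := by
  funext n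
  rw [lineWord_eq_ite_iterate_billiardStep hθ₁ hθ₂, foldState_eq_self hx₁ hx₂]
  rfl

theorem LineAvoidsCorners.billiardAvoidsCorners {x : ℝ × ℝ} (h : LineAvoidsCorners x θ)
    (hx₁ : x.1 ∈ Set.Ico 0 1) (hx₂ : x.2 ∈ Set.Ico 0 1) (hθ₁ : 0 < θ.1) (hθ₂ : 0 < θ.2) :
    BilliardAvoidsCorners x θ := by
  intro n
  obtain ⟨t, ht, hstate⟩ := exists_iterate_billiardStep_foldState hθ₁ hθ₂ x n
  rw [hitPoint, ← foldState_eq_self hx₁ hx₂ θ, hstate, foldState,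
    foldPoint_mem_verticalEdges_iff, foldPoint_mem_horizontalEdges_iff]
  exact h t ht

end Billiard

/-! ### Rotations as cutting sequences -/

section Rotation

variable {α y : ℝ}

theorem lineTimes_antidiagonal_inter_Iic_of_lt (hα : α ∈ Set.Ioo 0 1) (hy : 0 < y)
    (hyα : y < 1 - α) :
    lineTimes (1 - y, y) (1 - α, α) ∩ Set.Iic 1 = {y / (1 - α)} := by
  have hfloor₁ : ⌊1 - y⌋ = 0 := Int.floor_eq_zero_iff.2 ⟨by linarith [hα.1], by linarith⟩
  have hfloor₂ : ⌊y⌋ = 0 := Int.floor_eq_zero_iff.2 ⟨hy.le, by linarith [hα.1]⟩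
  rw [lineTimes_eq_union, Set.union_inter_distrib_right,
    crossingTimes_inter_Iic_eq_singleton (sub_pos.2 hα.2),
    crossingTimes_inter_Iic_eq_empty hα.1, Set.union_empty, hfloor₁]
  · norm_num
  · rw [hfloor₂]
    norm_num
    linarith
  · rw [hfloor₁]
    constructor <;> norm_num <;> linarith [hα.1]

theorem lineTimes_antidiagonal_inter_Iic_of_gt (hα : α ∈ Set.Ioo 0 1) (hy : y < 1)
    (hyα : 1 - α < y) :
    lineTimes (1 - y, y) (1 - α, α) ∩ Set.Iic 1 = {(1 - y) / α} := by
  have hfloor₁ : ⌊1 - y⌋ = 0 := Int.floor_eq_zero_iff.2 ⟨by linarith, by linarith [hα.2]⟩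
  have hfloor₂ : ⌊y⌋ = 0 := Int.floor_eq_zero_iff.2 ⟨by linarith [hα.2], hy⟩
  rw [lineTimes_eq_union, Set.union_inter_distrib_right,
    crossingTimes_inter_Iic_eq_empty (sub_pos.2 hα.2),
    crossingTimes_inter_Iic_eq_singleton hα.1, Set.empty_union, hfloor₂]
  · norm_num
  · rw [hfloor₂]
    constructor <;> norm_num <;> linarith [hα.2]
  · rw [hfloor₁]
    norm_num
    linarith

theorem lineAvoidsCorners_zero (hirr : Irrational α) : LineAvoidsCorners (0, 0) (1 - α, α) := by
  rintro t ht ⟨⟨k, hk : 0 + t * (1 - α) = k⟩, ⟨l, hl : 0 + t * α = l⟩⟩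
  have ht_eq : t = (k + l : ℤ) := by
    push_cast
    linarith
  have hkl : k + l ≠ 0 := by
    rintro h
    rw [ht_eq, h, Int.cast_zero] at ht
    exact lt_irrefl 0 ht
  refine (hirr.intCast_mul hkl).ne_int l ?_
  rw [← ht_eq, ← hl, zero_add]

theorem lineWord_antidiagonal_zero_of_lt (hα : α ∈ Set.Ioo 0 1) (hy : 0 < y) (hyα : y < 1 - α) :
    lineWord (1 - y, y) (1 - α, α) 0 = .one := by
  rw [lineWord_zero (isLeast_of_inter_Iic_eq_singleton
    (lineTimes_antidiagonal_inter_Iic_of_lt hα hy hyα)), if_pos]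
  refine ⟨1, ?_⟩
  simp [div_mul_cancel₀ y (sub_pos.2 hα.2).ne']

theorem lineWord_antidiagonal_zero_of_gt (hα : α ∈ Set.Ioo 0 1) (hy : y < 1) (hyα : 1 - α < y)
    (h : LineAvoidsCorners (1 - y, y) (1 - α, α)) :
    lineWord (1 - y, y) (1 - α, α) 0 = .two := by
  have hleast := isLeast_of_inter_Iic_eq_singleton
    (lineTimes_antidiagonal_inter_Iic_of_gt hα hy hyα)
  rw [lineWord_zero hleast, if_neg]
  refine fun hvert => h _ hleast.1.1 ⟨hvert, 1, ?_⟩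
  simp [div_mul_cancel₀ (1 - y) hα.1.ne']

theorem LineAvoidsCorners.ne_one_sub (h : LineAvoidsCorners (1 - y, y) (1 - α, α)) :
    y ≠ 1 - α := by
  rintro rfl
  exact h 1 one_pos ⟨⟨1, by simp⟩, ⟨1, by simp⟩⟩

theorem antidiagonal_add_smul (y α : ℝ) :
    (1 - y, y) + (1 : ℝ) • (1 - α, α) =
      (1 - rotation α y, rotation α y) + (((1 - ⌊y + α⌋ : ℤ) : ℝ), (⌊y + α⌋ : ℝ)) := by
  have hrot : rotation α y + ⌊y + α⌋ = y + α := Int.fract_add_floor (y + α)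
  refine Prod.ext ?_ ?_
  · simp only [Prod.fst_add, Prod.smul_fst, smul_eq_mul]
    push_cast
    linarith
  · simp only [Prod.snd_add, Prod.smul_snd, smul_eq_mul]
    linarith

theorem LineAvoidsCorners.antidiagonal_rotation
    (h : LineAvoidsCorners (1 - y, y) (1 - α, α)) :
    LineAvoidsCorners (1 - rotation α y, rotation α y) (1 - α, α) := by
  rw [← lineAvoidsCorners_add_intCast_iff, ← antidiagonal_add_smul]
  exact h.translate zero_le_one

theorem lineWord_antidiagonal_succ {r : ℝ}
    (h : lineTimes (1 - y, y) (1 - α, α) ∩ Set.Iic 1 = {r}) (n : ℕ) :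
    lineWord (1 - y, y) (1 - α, α) (n + 1) =
      lineWord (1 - rotation α y, rotation α y) (1 - α, α) n := by
  rw [lineWord_succ zero_le_one h, antidiagonal_add_smul, lineWord_add_intCast]

theorem rotationWord_eq_lineWord (hα : α ∈ Set.Ioo 0 1) (hy : y ∈ Set.Ioo 0 1)
    (h : LineAvoidsCorners (1 - y, y) (1 - α, α)) :
    rotationWord y α = lineWord (1 - y, y) (1 - α, α) := by
  funext n
  induction n generalizing y with
  | zero =>
    rcases h.ne_one_sub.lt_or_gt with hlt | hgt
    · rw [rotationWord_zero_of_lt hy.1.le hlt, lineWord_antidiagonal_zero_of_lt hα hy.1 hlt]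
    · rw [rotationWord_zero_of_le hgt.le, lineWord_antidiagonal_zero_of_gt hα hy.2 hgt h]
  | succ n ih =>
    rw [rotationWord_succ]
    rcases h.ne_one_sub.lt_or_gt with hlt | hgt
    · have hrot := rotation_of_lt hα.1.le hy.1.le hlt
      rw [lineWord_antidiagonal_succ (lineTimes_antidiagonal_inter_Iic_of_lt hα hy.1 hlt)]
      exact ih (hrot ▸ ⟨add_pos hy.1 hα.1, by linarith⟩) h.antidiagonal_rotation
    · have hrot := rotation_of_le hα.2.le hy.2 hgt.le
      rw [lineWord_antidiagonal_succ (lineTimes_antidiagonal_inter_Iic_of_gt hα hy.2 hgt)]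
      exact ih (hrot ▸ ⟨by linarith, by linarith [hy.2, hα.2]⟩) h.antidiagonal_rotation

theorem rotationWord_self_eq_lineWord (hα : α ∈ Set.Ioo 0 1) (hirr : Irrational α) :
    rotationWord α α = lineWord (0, 0) (1 - α, α) := by
  have hempty : lineTimes (0, 0) (1 - α, α) ∩ Set.Iic 1 = ∅ := by
    rw [lineTimes_eq_union, Set.union_inter_distrib_right,
      crossingTimes_inter_Iic_eq_empty (sub_pos.2 hα.2) (by simpa using hα.1),
      crossingTimes_inter_Iic_eq_empty hα.1 (by simpa using hα.2), Set.union_empty]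
  have hshift : ((0, 0) : ℝ × ℝ) + (1 : ℝ) • (1 - α, α) = (1 - α, α) := by simp
  rw [lineWord_eq_lineWord_add_smul zero_le_one hempty, hshift]
  refine rotationWord_eq_lineWord hα hα ?_
  have havoid := (lineAvoidsCorners_zero hirr).translate zero_le_one
  rwa [hshift] at havoid

end Rotation

/-! ### The linear flow on the torus -/

section Flow

variable {x θ : ℝ × ℝ}

theorem coe_eq_zero_iff_exists_intCast (y : ℝ) : (y : UnitAddCircle) = 0 ↔ ∃ k : ℤ, y = k := by
  rw [AddCircle.coe_eq_zero_iff]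
  simp only [zsmul_one, eq_comm]

theorem torusFlow_coe_mem_sectionVertical_iff (t : ℝ) :
    torusFlow θ t (x.1, x.2) ∈ sectionVertical ↔ x + t • θ ∈ gridVertical :=
  coe_eq_zero_iff_exists_intCast (x.1 + t * θ.1)

theorem torusFlow_coe_mem_sectionHorizontal_iff (t : ℝ) :
    torusFlow θ t (x.1, x.2) ∈ sectionHorizontal ↔ x + t • θ ∈ gridHorizontal :=
  coe_eq_zero_iff_exists_intCast (x.2 + t * θ.2)

theorem flowWord_coe (x θ : ℝ × ℝ) : flowWord (x.1, x.2) θ = lineWord x θ := by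
  classical
  funext n
  refine if_congr ?_ rfl rfl
  simp only [flowTimes, lineTimes, Set.mem_union, torusFlow_coe_mem_sectionVertical_iff,
    torusFlow_coe_mem_sectionHorizontal_iff]

theorem flowAvoidsCorner_coe_iff : FlowAvoidsCorner (x.1, x.2) θ ↔ LineAvoidsCorners x θ := by
  refine forall₂_congr fun t _ => not_congr ?_
  rw [← torusFlow_coe_mem_sectionVertical_iff, ← torusFlow_coe_mem_sectionHorizontal_iff]
  exact Prod.ext_iff

end Flow

end Sturmian

theorem mainTheorem10 (w : Sturmian.InfWord) (hw : Sturmian.IsStandardSturmian w) :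
    (∃ f₁ f₂ : ℝ, Sturmian.HasLetterFreq w .one f₁ ∧ Sturmian.HasLetterFreq w .two f₂) ∧
    ∀ f₁ f₂ : ℝ, Sturmian.HasLetterFreq w .one f₁ → Sturmian.HasLetterFreq w .two f₂ →
      (0 < f₁ ∧ 0 < f₂ ∧ f₂ < 1) ∧
      (Sturmian.BilliardAvoidsCorners (0, 0) (f₁, f₂) ∧
        w = Sturmian.billiardWord (0, 0) (f₁, f₂)) ∧
      (Sturmian.LineAvoidsCorners (0, 0) (f₁, f₂) ∧
        w = Sturmian.lineWord (0, 0) (f₁, f₂)) ∧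
      (Sturmian.FlowAvoidsCorner (0, 0) (f₁, f₂) ∧
        w = Sturmian.flowWord (0, 0) (f₁, f₂)) ∧
      w = Sturmian.rotationWord f₂ f₂ := by
  obtain ⟨α, hα, hirr, rfl⟩ := hw.exists_eq_rotationWord
  have htwo := Sturmian.hasLetterFreq_two_rotationWord ⟨hα.1.le, hα.2.le⟩ ⟨hα.1.le, hα.2⟩
  have hone := htwo.one_of_two
  refine ⟨⟨1 - α, α, hone, htwo⟩, fun f₁ f₂ hf₁ hf₂ => ?_⟩
  obtain rfl : f₁ = 1 - α := tendsto_nhds_unique hf₁ hone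
  obtain rfl : f₂ = α := tendsto_nhds_unique hf₂ htwo
  have hline := Sturmian.rotationWord_self_eq_lineWord hα hirr
  have havoid := Sturmian.lineAvoidsCorners_zero hirr
  have hpos : 0 < 1 - f₂ := sub_pos.2 hα.2
  have hzero : (0 : ℝ) ∈ Set.Ico 0 1 := Set.left_mem_Ico.2 one_pos
  exact ⟨⟨hpos, hα⟩,
    ⟨havoid.billiardAvoidsCorners hzero hzero hpos hα.1,
      hline.trans (Sturmian.billiardWord_eq_lineWord hzero hzero hpos hα.1).symm⟩,
    ⟨havoid, hline⟩,
    ⟨Sturmian.flowAvoidsCorner_coe_iff.2 havoid, hline.trans (Sturmian.flowWord_coe _ _).symm⟩,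
    rfl⟩
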